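/- Let $d\in\{2,3\}$, let $\Omega\subset\mathbb R^d$ be a bounded, connected open set, let $X=H^1_0(\Omega)^d$, $Q=\{q\in L^2(\Omega):\int_\Omega q\,dx=0\}$ and $V=\{v\in X:(\nabla\cdot v,q)=0\ \forall q\in Q\}$, where $(\cdot,\cdot)$ and $\|\cdot\|$ are the $L^2(\Omega)$ inner product and norm (and $(\cdot,\cdot)$ also denotes duality pairings). Write $(v\cdot\nabla w,\chi)=\int_\Omega\sum_{i,j}v_j\,(\partial_jw_i)\,\chi_i\,dx$, and let $M$ be a constant with $(v\cdot\nabla w,\chi)\le M\|\nabla v\|\,\|\nabla w\|\,\|\nabla\chi\|$ for all $v,w,\chi\in V$. Let $\nu>0$ and $f\in X'=H^{-1}(\Omega)^d$, and set $\|f\|_{-1}=\sup_{0\ne\chi\in X}(f,\chi)/\|\nabla\chi\|$, $\|\phi\|_{V'}=\sup_{0\ne\chi\in V}(\phi,\chi)/\|\nabla\chi\|$ for $\phi\in V'$, and $\kappa=M\nu^{-2}\|f\|_{-1}$. The nonlinear residual $g:V\to V'$ of the steady Navier–Stokes equations is defined by $$(g(v),\chi)=\nu(\nabla v,\nabla\chi)+(v\cdot\nabla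 v,\chi)-(f,\chi)\qquad\forall\chi\in V,$$ and for $u\in V$ the Picard iterate $q(u)\in V$ is defined by $$\nu(\nabla q(u),\nabla\chi)+(u\cdot\nabla q(u),\chi)=(f,\chi)\qquad\forall\chi\in V.$$ Let $u_0\in V$, and let $u_1,u_2,\dots$ be generated by AAg with depth $m=1$: in step $j=0,1,2,\dots$, with $\tilde u_{i+1}=q(u_i)$ and $m_j=\min\{j,1\}$, the real coefficients $\alpha^{(j)}_i$, $j-m_j+1\le i\le j+1$, minimize $\big\|\sum_{i}\alpha_i^{(j)} g(\tilde u_i)\big\|_{V'}^2$ subject to $\sum_{i}\alpha_i^{(j)}=1$, and $u_{j+1}=\sum_{i}\alpha_i^{(j)}\tilde u_i$. Suppose that $\kappa<1$. Let $k>1$, suppose that steps $0,\dots,k$ have been carried out, write $\alpha_i=\alpha_i^{(k)}$, let $\bar\alpha$ be a number with $|\alpha_k|,|\alpha_{k+1}|\le\bar\alpha$, and put $$\theta_{k+1}=\frac{\|\alpha_{k+1}g(\tilde u_{k+1})+\alpha_kg(\tilde u_k)\|_{V'}}{\|g(\tilde u_{k+1})\|_{V'}},\qquad \gamma_{k+1}=\frac{\|\alpha_{k+1}g(\tilde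 u_{k+1})+\alpha_kg(\tilde u_k)\|_{V'}}{\|g(u_k)\|_{V'}}$$ (if a denominator vanishes, so does the numerator, and the quotient is read as $0$). Then $$\|g(u_{k+1})\|_{V'}\le\theta_{k+1}\,\kappa\,\|g(u_k)\|_{V'}+\frac{2M\bar\alpha^2\kappa^2}{\nu^2(1-\kappa)^2}\left(\|g(u_k)\|_{V'}^2+\|g(u_{k-1})\|_{V'}^2\right)$$ and $$\|g(u_{k+1})\|_{V'}\le\gamma_{k+1}\,\|g(u_k)\|_{V'}+\frac{2M\bar\alpha^2\kappa^2}{\nu^2(1-\kappa)^2}\left(\|g(u_k)\|_{V'}^2+\|g(u_{k-1})\|_{V'}^2\right).$$ -/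

import Mathlib

open MeasureTheory
open scoped ENNReal ContDiff

noncomputable section

namespace NSE

/-- Points and velocity vectors: `ℝᵈ` with the Euclidean norm. -/
abbrev Vec (d : ℕ) : Type := EuclideanSpace ℝ (Fin d)

/-- `d × d` matrices with the Frobenius norm; the entry `(i, j)` of a velocity gradient is
`∂ⱼ vᵢ`. -/
abbrev Mat (d : ℕ) : Type := EuclideanSpace ℝ (Fin d × Fin d)

variable {d : ℕ}

/-- Lebesgue measure on `Ω`. -/
abbrev vol (Ω : Set (Vec d)) : Measure (Vec d) := volume.restrict Ω

/-- `L²(Ω)ᵈ × L²(Ω)ᵈˣᵈ`, with the Hilbert norm `(‖v‖² + ‖G‖²)^{1/2}`. A field in `H¹` is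
represented by the pair `(v, ∇v)`, so that this is the `H¹` norm. -/
abbrev L2Pair (Ω : Set (Vec d)) : Type :=
  WithLp 2 (Lp (Vec d) 2 (vol Ω) × Lp (Mat d) 2 (vol Ω))

/-- The classical gradient, `(∇φ)ᵢⱼ = ∂ⱼ φᵢ`. -/
def classicalGrad (φ : Vec d → Vec d) (x : Vec d) : Mat d :=
  WithLp.toLp 2 fun p => (fderiv ℝ φ x (EuclideanSpace.single p.2 1)) p.1

/-- `φ ∈ C_c^∞(Ω)ᵈ`. -/
structure IsTestField (Ω : Set (Vec d)) (φ : Vec d → Vec d) : Prop where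
  smooth : ContDiff ℝ ∞ φ
  compact : HasCompactSupport φ
  support : tsupport φ ⊆ Ω

/-- The pairs `(φ, ∇φ)`, `φ ∈ C_c^∞(Ω)ᵈ`, as classes in `L²`. -/
def testPairs (Ω : Set (Vec d)) : Submodule ℝ (L2Pair Ω) where
  carrier := {z | ∃ φ : Vec d → Vec d, IsTestField Ω φ ∧
    z.fst =ᵐ[vol Ω] φ ∧ z.snd =ᵐ[vol Ω] classicalGrad φ}
  zero_mem' := by
    refine ⟨0, ⟨contDiff_const, HasCompactSupport.zero, ?_⟩, ?_, ?_⟩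
    · simp [tsupport]
    · exact Lp.coeFn_zero _ _ _
    · refine (Lp.coeFn_zero (Mat d) 2 (vol Ω)).trans (Filter.Eventually.of_forall fun x => ?_)
      ext p
      simp [classicalGrad]
  add_mem' := by
    rintro z w ⟨φ, hφ, h1, h2⟩ ⟨ψ, hψ, h3, h4⟩
    refine ⟨φ + ψ, ⟨hφ.smooth.add hψ.smooth, hφ.compact.add hψ.compact, ?_⟩, ?_, ?_⟩
    · exact (tsupport_add φ ψ).trans (Set.union_subset hφ.support hψ.support)
    · exact (Lp.coeFn_add z.fst w.fst).trans (h1.add h3)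
    · refine (Lp.coeFn_add z.snd w.snd).trans ((h2.add h4).trans
        (Filter.Eventually.of_forall fun x => ?_))
      have e : fderiv ℝ (φ + ψ) x = fderiv ℝ φ x + fderiv ℝ ψ x :=
        fderiv_add (hφ.smooth.differentiable (by simp) x) (hψ.smooth.differentiable (by simp) x)
      ext p
      simp [classicalGrad, e]
  smul_mem' := by
    rintro c z ⟨φ, hφ, h1, h2⟩
    refine ⟨c • φ, ⟨hφ.smooth.const_smul c, hφ.compact.smul_left (f := fun _ => c), ?_⟩, ?_, ?_⟩
    · exact (tsupport_smul_subset_right (fun _ => c) φ).trans hφ.support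
    · exact (Lp.coeFn_smul c z.fst).trans (h1.const_smul c)
    · refine (Lp.coeFn_smul c z.snd).trans ((h2.const_smul c).trans
        (Filter.Eventually.of_forall fun x => ?_))
      have e : fderiv ℝ (c • φ) x = c • fderiv ℝ φ x :=
        fderiv_const_smul (hφ.smooth.differentiable (by simp) x) c
      ext p
      simp [classicalGrad, e]

/-- The velocity space `X = H¹₀(Ω)ᵈ`: the closure of `C_c^∞(Ω)ᵈ` in the `H¹` norm. The second
component of an element is the weak gradient of the first one, hence is determined by it. -/
abbrev X (Ω : Set (Vec d)) : Submodule ℝ (L2Pair Ω) := (testPairs Ω).topologicalClosure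

variable {Ω : Set (Vec d)}

/-- The velocity field, in `L²(Ω)ᵈ`. -/
def vel (v : X Ω) : Lp (Vec d) 2 (vol Ω) := (v : L2Pair Ω).fst

/-- The velocity gradient, in `L²(Ω)ᵈˣᵈ`. -/
def grad (v : X Ω) : Lp (Mat d) 2 (vol Ω) := (v : L2Pair Ω).snd

/-- The trace of a matrix. -/
def traceCLM (d : ℕ) : Mat d →L[ℝ] ℝ := ∑ i, EuclideanSpace.proj (i, i)

/-- The divergence `∇ · v`, in `L²(Ω)`. -/
def div (v : X Ω) : Lp ℝ 2 (vol Ω) := (traceCLM d).compLp (grad v)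

/-- The pressure space `Q = {q ∈ L²(Ω) : ∫_Ω q = 0}`. -/
def Q (Ω : Set (Vec d)) : Set (Lp ℝ 2 (vol Ω)) := {q | ∫ x, q x ∂(vol Ω) = 0}

/-- The divergence-free space `V = {v ∈ X : (∇ · v, q) = 0 for all q ∈ Q}`. -/
def V (Ω : Set (Vec d)) : Submodule ℝ (X Ω) where
  carrier := {v | ∀ q ∈ Q Ω, inner ℝ (div v) q = 0}
  zero_mem' := by
    intro q _
    have : div (0 : X Ω) = 0 := ((traceCLM d).compLpL 2 (vol Ω)).map_zero
    rw [this, inner_zero_left]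
  add_mem' := by
    intro v w hv hw q hq
    have : div (v + w) = div v + div w :=
      ((traceCLM d).compLpL 2 (vol Ω)).map_add (grad v) (grad w)
    rw [this, inner_add_left, hv q hq, hw q hq, add_zero]
  smul_mem' := by
    intro c v hv q hq
    have : div (c • v) = c • div v := ((traceCLM d).compLpL 2 (vol Ω)).map_smul c (grad v)
    rw [this, inner_smul_left, hv q hq, mul_zero]

/-- The form `(v · ∇w, χ) = ∫_Ω ∑ᵢⱼ vⱼ (∂ⱼ wᵢ) χᵢ`. -/
def conv (v w χ : X Ω) : ℝ :=
  ∫ x, ∑ i, ∑ j, vel v x j * grad w x (i, j) * vel χ x i ∂(vol Ω)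

/-- The best constant in `(v · ∇w, χ) ≤ M ‖∇v‖ ‖∇w‖ ‖∇χ‖` for `v, w, χ ∈ V`. -/
def convConst (Ω : Set (Vec d)) : ℝ :=
  ⨆ p : V Ω × V Ω × V Ω,
    conv (p.1 : X Ω) p.2.1 p.2.2 /
      (‖grad (p.1 : X Ω)‖ * ‖grad (p.2.1 : X Ω)‖ * ‖grad (p.2.2 : X Ω)‖)

/-- `H⁻¹(Ω)`, the dual space of `X`. -/
abbrev HNegOne (Ω : Set (Vec d)) : Type := X Ω →L[ℝ] ℝ

/-- `‖f‖₋₁ = sup { (f, χ) / ‖∇χ‖ : 0 ≠ χ ∈ X }`. -/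
def normNegOne (f : HNegOne Ω) : ℝ := ⨆ χ : {χ : X Ω // χ ≠ 0}, f χ / ‖grad χ.1‖

/-- `‖φ‖_{V'} = sup { (φ, χ) / ‖∇χ‖ : 0 ≠ χ ∈ V }`, for a functional `φ` on `V`. -/
def normV' (φ : V Ω → ℝ) : ℝ := ⨆ χ : {χ : V Ω // χ ≠ 0}, φ χ / ‖grad (χ.1 : X Ω)‖

/-- The nonlinear residual, `(g(v), χ) = ν(∇v, ∇χ) + (v · ∇v, χ) - (f, χ)` for `χ ∈ V`. -/
def g (ν : ℝ) (f : HNegOne Ω) (v : V Ω) : V Ω → ℝ := fun χ =>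
  ν * inner ℝ (grad (v : X Ω)) (grad (χ : X Ω)) + conv (v : X Ω) v χ - f χ

/-- `w = q(u)`: `w ∈ V` solves `ν(∇w, ∇χ) + (u · ∇w, χ) = (f, χ)` for all `χ ∈ V`. -/
def IsPicard (ν : ℝ) (f : HNegOne Ω) (u w : V Ω) : Prop :=
  ∀ χ : V Ω, ν * inner ℝ (grad (w : X Ω)) (grad (χ : X Ω)) + conv (u : X Ω) w χ = f χ

/-- The indices `k - mₖ + 1, …, k + 1` used in step `k` at depth `m`, with `mₖ = min {k, m}`. -/
def window (m k : ℕ) : Finset ℕ := Finset.Icc (k - min k m + 1) (k + 1)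

/-- The functional `∑ⱼ βⱼ g(ũⱼ)`, `j` in the window of step `k`. -/
def combRes (ν : ℝ) (f : HNegOne Ω) (m k : ℕ) (ut : ℕ → V Ω) (β : ℕ → ℝ) : V Ω → ℝ :=
  ∑ j ∈ window m k, β j • g ν f (ut j)

/-- `u₀, …, u_{n+1}` are produced by the steps `0, …, n` of AAg with depth `m` for the Picard
iteration; `ut (k + 1)` is `ũ_{k+1} = q(u_k)` and `α k j` is the coefficient `αⱼ^{(k)}`. -/
structure IsAAg (ν : ℝ) (f : HNegOne Ω) (m n : ℕ) (u ut : ℕ → V Ω) (α : ℕ → ℕ → ℝ) : Prop where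
  picard : ∀ k ≤ n, IsPicard ν f (u k) (ut (k + 1))
  sum_eq_one : ∀ k ≤ n, ∑ j ∈ window m k, α k j = 1
  minimal : ∀ k ≤ n, ∀ β : ℕ → ℝ, ∑ j ∈ window m k, β j = 1 →
    normV' (combRes ν f m k ut (α k)) ^ 2 ≤ normV' (combRes ν f m k ut β) ^ 2
  update : ∀ k ≤ n, u (k + 1) = ∑ j ∈ window m k, α k j • ut j

/-- `κ = M ν⁻² ‖f‖₋₁`. -/
def kappa (M ν : ℝ) (f : HNegOne Ω) : ℝ := M * (ν ^ 2)⁻¹ * normNegOne f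

/-- The gain `θ_{k+1} = ‖∑ⱼ αⱼ g(ũⱼ)‖_{V'} / ‖g(ũ_{k+1})‖_{V'}`; equal to `0` if the
denominator vanishes (the numerator is then `0` for minimizing coefficients). -/
def gain (ν : ℝ) (f : HNegOne Ω) (m k : ℕ) (ut : ℕ → V Ω) (α : ℕ → ℕ → ℝ) : ℝ :=
  normV' (combRes ν f m k ut (α k)) / normV' (g ν f (ut (k + 1)))

/-- The rate `γ_{k+1} = ‖∑ⱼ αⱼ g(ũⱼ)‖_{V'} / ‖g(u_k)‖_{V'}`; equal to `0` if the denominator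
vanishes. -/
def rate (ν : ℝ) (f : HNegOne Ω) (m k : ℕ) (u ut : ℕ → V Ω) (α : ℕ → ℕ → ℝ) : ℝ :=
  normV' (combRes ν f m k ut (α k)) / normV' (g ν f (u k))

end NSE

end

/-!
The step `k` combines the Picard iterates `w' = q(u_{k-1})` and `w = q(u_k)` with coefficients
`a + b = 1`. The residual `g` is affine up to the quadratic convective term, so that
`g(a w' + b w) = a g(w') + b g(w) - a b ((w - w') · ∇(w - w'), ·)` (`g_affine_comb`). The linear part
is the quantity minimized by the algorithm; it equals `gain * ‖g(w)‖ = rate * ‖g(u_k)‖`, and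
`‖g(w)‖ ≤ κ ‖g(u_k)‖` (`IsPicard.normV'_g_le`) because `g(w) = ((w - u_k) · ∇w, ·)`, where the
increment `w - u_k` is controlled by the residual `g(u_k)` (`IsPicard.norm_grad_sub_le`) and `w` by
the data (`IsPicard.norm_grad_le`). For the quadratic part, the Picard map is a contraction with
factor `κ`; writing `u_k - u_{k-1} = (u_k - w) + (w - w') - (u_{k-1} - w')` and absorbing `w - w'`
bounds `‖∇(w - w')‖` by the two residuals (`IsPicard.norm_grad_sub_le_residuals`).

These estimates use three analytic facts about `H¹₀`. By the Gagliardo–Nirenberg–Sobolev inequality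
`X` embeds into `L⁴` and satisfies a Poincaré inequality (`exists_isSobolevConst`,
`exists_norm_le_grad`), so that the suprema defining the constant `M` and the dual norms are over
bounded sets. A field in `V` is pointwise divergence free, since its divergence has mean zero
(`div_eq_zero`). Hence the convective term is skew-symmetric (`conv_skew`), by integration by parts
for test fields and density.
-/

noncomputable section

namespace NSE

variable {d : ℕ} {Ω : Set (Vec d)}

/-! ### Linearity of the velocity and of its gradient -/

lemma vel_add (v w : X Ω) : vel (v + w) = vel v + vel w := rfl
lemma vel_smul (c : ℝ) (v : X Ω) : vel (c • v) = c • vel v := rfl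
lemma grad_add (v w : X Ω) : grad (v + w) = grad v + grad w := rfl
lemma grad_sub (v w : X Ω) : grad (v - w) = grad v - grad w := rfl
lemma grad_neg (v : X Ω) : grad (-v) = -grad v := rfl
lemma grad_smul (c : ℝ) (v : X Ω) : grad (c • v) = c • grad v := rfl
lemma grad_zero : grad (0 : X Ω) = 0 := rfl

lemma continuous_vel : Continuous (vel : X Ω → _) :=
  (WithLp.continuous_fst 2 _ _).comp continuous_subtype_val

lemma continuous_grad : Continuous (grad : X Ω → _) :=
  (WithLp.continuous_snd 2 _ _).comp continuous_subtype_val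

/-- The elements of `X` given by test fields. -/
def testSet (Ω : Set (Vec d)) : Set (X Ω) := {v | (v : L2Pair Ω) ∈ testPairs Ω}

lemma dense_testSet : Dense (testSet Ω) := by
  rw [Subtype.dense_iff]
  intro z hz
  have hz' : z ∈ closure (testPairs Ω : Set (L2Pair Ω)) := hz
  refine closure_mono (fun w hw => ?_) hz'
  exact ⟨⟨w, (testPairs Ω).le_topologicalClosure hw⟩, hw, rfl⟩

/-- A continuous linear functional on `X` is determined by its values on test fields. -/
lemma eq_zero_of_testSet (L : X Ω →ₗ[ℝ] ℝ) (C : ℝ) (hC : ∀ v, |L v| ≤ C * ‖v‖)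
    (h : ∀ v ∈ testSet Ω, L v = 0) (v : X Ω) : L v = 0 := by
  have hc : Continuous L := (L.mkContinuous C hC).continuous
  have := hc.ext_on dense_testSet continuous_const (f := L) (g := fun _ => (0 : ℝ)) h
  exact congrFun this v

lemma norm_grad_le (v : X Ω) : ‖grad v‖ ≤ ‖v‖ := WithLp.norm_snd_le _ (v : L2Pair Ω)

lemma norm_le_vel_add_grad (v : X Ω) : ‖v‖ ≤ ‖vel v‖ + ‖grad v‖ := by
  have h : ‖v‖ ^ 2 = ‖vel v‖ ^ 2 + ‖grad v‖ ^ 2 := WithLp.prod_norm_sq_eq_of_L2 (v : L2Pair Ω)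
  nlinarith [norm_nonneg v, norm_nonneg (vel v), norm_nonneg (grad v)]

/-! ### Sobolev and Poincaré inequalities -/

/-- The operator norm of the derivative is controlled by the Frobenius norm of the gradient. -/
lemma norm_fderiv_le (φ : Vec d → Vec d) (x : Vec d) :
    ‖fderiv ℝ φ x‖ ≤ (d : ℝ) * ‖classicalGrad φ x‖ := by
  have hcol (j : Fin d) :
      ‖fderiv ℝ φ x (EuclideanSpace.single j 1)‖ ≤ ‖classicalGrad φ x‖ := by
    rw [EuclideanSpace.norm_eq, EuclideanSpace.norm_eq]
    refine Real.sqrt_le_sqrt ?_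
    rw [Fintype.sum_prod_type]
    refine Finset.sum_le_sum fun i _ => ?_
    exact Finset.single_le_sum (f := fun j => ‖(classicalGrad φ x) (i, j)‖ ^ 2)
      (fun _ _ => by positivity) (Finset.mem_univ j)
  refine ContinuousLinearMap.opNorm_le_bound _ (by positivity) fun y => ?_
  have hy : y = ∑ j, y j • EuclideanSpace.single j (1 : ℝ) := by
    ext i
    simp [Finset.sum_apply, Pi.single_apply]
  calc ‖fderiv ℝ φ x y‖ = ‖∑ j, y j • fderiv ℝ φ x (EuclideanSpace.single j (1 : ℝ))‖ := by
        conv_lhs => rw [hy]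
        simp only [map_sum, map_smul]
    _ ≤ ∑ j : Fin d, ‖y‖ * ‖classicalGrad φ x‖ := by
        refine (norm_sum_le _ _).trans (Finset.sum_le_sum fun j _ => ?_)
        rw [norm_smul]
        exact mul_le_mul (PiLp.norm_apply_le y j) (hcol j) (norm_nonneg _) (norm_nonneg _)
    _ = d * ‖classicalGrad φ x‖ * ‖y‖ := by
        rw [Finset.sum_const, Finset.card_univ, Fintype.card_fin, nsmul_eq_mul]; ring

lemma classicalGrad_continuous {φ : Vec d → Vec d} (hφ : ContDiff ℝ ∞ φ) :
    Continuous (classicalGrad φ) := by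
  have h : Continuous (fderiv ℝ φ) := hφ.continuous_fderiv (by simp)
  refine (PiLp.continuous_toLp 2 _).comp (continuous_pi fun p => ?_)
  exact (EuclideanSpace.proj (𝕜 := ℝ) p.1).continuous.comp (h.clm_apply continuous_const)

lemma support_classicalGrad_subset (φ : Vec d → Vec d) :
    Function.support (classicalGrad φ) ⊆ tsupport φ := by
  intro x hx
  refine support_fderiv_subset ℝ (f := φ) fun h0 => hx ?_
  ext p
  simp [classicalGrad, h0]

lemma isFiniteMeasure_vol (hb : Bornology.IsBounded Ω) : IsFiniteMeasure (vol Ω) :=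
  ⟨by simpa using hb.measure_lt_top⟩

/-- The exponent `12/7` is below the dimension for both `d = 2` and `d = 3`, and its Sobolev
conjugate is at least `4` in both cases; Hölder's inequality on the bounded set `Ω` replaces the
`L^{12/7}` norm of the gradient by its `L²` norm. -/
lemma exists_eLpNorm_testField_le (hd : d = 2 ∨ d = 3) (hb : Bornology.IsBounded Ω)
    {q : NNReal} (hq0 : 0 < q) (hq : q ≤ 4) :
    ∃ C : NNReal, ∀ φ : Vec d → Vec d, IsTestField Ω φ →
      eLpNorm φ q (vol Ω) ≤ C * eLpNorm (classicalGrad φ) 2 (vol Ω) := by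
  have : IsFiniteMeasure (vol Ω) := isFiniteMeasure_vol hb
  obtain ⟨p, hpval⟩ : ∃ p : NNReal, (p : ℝ) = 12 / 7 := ⟨12 / 7, by norm_num⟩
  obtain ⟨r, hr⟩ : ∃ r : ℝ, r = 1 / (p : ℝ≥0∞).toReal - 1 / (2 : ℝ≥0∞).toReal := ⟨_, rfl⟩
  have hp2 : (p : ℝ≥0∞) ≤ 2 := by
    have : p ≤ 2 := by rw [← NNReal.coe_le_coe, hpval]; norm_num
    exact_mod_cast this
  have hr0 : 0 ≤ r := by
    rw [hr, ENNReal.coe_toReal, hpval]; norm_num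
  refine ⟨eLpNormLESNormFDerivOfLeConst (Vec d) (volume : Measure (Vec d)) Ω p q *
    (d * ((vol Ω Set.univ) ^ r).toNNReal), fun φ hφ => ?_⟩
  have hsupp : Function.support φ ⊆ Ω := (subset_tsupport φ).trans hφ.support
  have hdsupp : Function.support (fderiv ℝ φ) ⊆ Ω :=
    (support_fderiv_subset ℝ).trans hφ.support
  have hmain := eLpNorm_le_eLpNorm_fderiv_of_le (F := Vec d) (volume : Measure (Vec d))
    (u := φ) (s := Ω) (p := p) (q := q) (hφ.smooth.of_le (by simp)) hsupp
    (by rw [← NNReal.coe_le_coe, hpval]; norm_num)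
    (by
      rw [← NNReal.coe_lt_coe, hpval, finrank_euclideanSpace_fin]
      rcases hd with rfl | rfl <;> norm_num)
    (by
      have h4 : (4 : ℝ)⁻¹ ≤ (q : ℝ)⁻¹ :=
        inv_anti₀ (by exact_mod_cast hq0) (by exact_mod_cast hq)
      refine le_trans ?_ h4
      rw [NNReal.coe_inv, hpval, finrank_euclideanSpace_fin]
      rcases hd with rfl | rfl <;> norm_num) hb
  have e1 : eLpNorm φ q (vol Ω) = eLpNorm φ q volume :=
    eLpNorm_restrict_eq_of_support_subset (f := φ) hsupp
  have e2 : eLpNorm (fderiv ℝ φ) p (vol Ω) = eLpNorm (fderiv ℝ φ) p volume :=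
    eLpNorm_restrict_eq_of_support_subset (f := fderiv ℝ φ) hdsupp
  have e3 : eLpNorm (fderiv ℝ φ) p (vol Ω) ≤ d * eLpNorm (classicalGrad φ) p (vol Ω) := by
    have := eLpNorm_le_nnreal_smul_eLpNorm_of_ae_le_mul (μ := vol Ω) (c := (d : NNReal))
      (f := fderiv ℝ φ) (g := classicalGrad φ)
      (Filter.Eventually.of_forall fun x => by
        have := norm_fderiv_le φ x
        exact_mod_cast this) p
    simpa [ENNReal.smul_def] using this
  have e4 := eLpNorm_le_eLpNorm_mul_rpow_measure_univ (μ := vol Ω) hp2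
    (classicalGrad_continuous hφ.smooth).aestronglyMeasurable
  have e5 : (((vol Ω Set.univ) ^ r).toNNReal : ℝ≥0∞) = (vol Ω Set.univ) ^ r :=
    ENNReal.coe_toNNReal (ENNReal.rpow_ne_top_of_nonneg hr0 (measure_ne_top _ _))
  rw [← hr] at e4
  rw [e1]
  refine hmain.trans ?_
  rw [← e2, ENNReal.coe_mul, ENNReal.coe_mul, e5, ENNReal.coe_natCast, mul_assoc]
  refine mul_le_mul_right (e3.trans ?_) _
  rw [mul_assoc]
  refine mul_le_mul_right ?_ _
  rw [mul_comm]
  exact e4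

/-- Sobolev embedding `H¹₀ ⊆ L^q`, `q ≤ 4`. By density from test fields, the `L^q` norm being lower
semicontinuous under convergence in `L²`. -/
lemma exists_eLpNorm_vel_le (hd : d = 2 ∨ d = 3) (hb : Bornology.IsBounded Ω)
    {q : NNReal} (hq0 : 0 < q) (hq : q ≤ 4) :
    ∃ C : NNReal, ∀ v : X Ω, eLpNorm (vel v) q (vol Ω) ≤ C * ‖grad v‖ₑ := by
  obtain ⟨C, hC⟩ := exists_eLpNorm_testField_le hd hb hq0 hq
  refine ⟨C, fun v => ?_⟩
  have htest : ∀ w ∈ testSet Ω, eLpNorm (vel w) q (vol Ω) ≤ C * ‖grad w‖ₑ := by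
    rintro w ⟨φ, hφ, h1, h2⟩
    have e1 : eLpNorm (vel w) q (vol Ω) = eLpNorm φ q (vol Ω) := eLpNorm_congr_ae h1
    have e2 : ‖grad w‖ₑ = eLpNorm (classicalGrad φ) 2 (vol Ω) :=
      (Lp.enorm_def _).trans (eLpNorm_congr_ae h2)
    rw [e1, e2]
    exact hC φ hφ
  obtain ⟨w, hw, hlim⟩ := mem_closure_iff_seq_limit.1 (dense_testSet (Ω := Ω) v)
  have hvel : Filter.Tendsto (fun n => vel (w n)) Filter.atTop (nhds (vel v)) :=
    (continuous_vel.tendsto v).comp hlim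
  have hgrad : Filter.Tendsto (fun n => C * ‖grad (w n)‖ₑ) Filter.atTop (nhds (C * ‖grad v‖ₑ)) :=
    ENNReal.Tendsto.const_mul
      ((continuous_enorm.tendsto _).comp ((continuous_grad.tendsto v).comp hlim))
      (Or.inr ENNReal.coe_ne_top)
  obtain ⟨ns, hns, hae⟩ := (tendstoInMeasure_of_tendsto_Lp hvel).exists_seq_tendsto_ae
  refine (Lp.eLpNorm_lim_le_liminf_eLpNorm (fun n => Lp.aestronglyMeasurable (vel (w (ns n))))
    _ hae).trans ?_
  rw [← (hgrad.comp hns.tendsto_atTop).liminf_eq]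
  exact Filter.liminf_le_liminf (Filter.Eventually.of_forall fun n => htest _ (hw (ns n)))

lemma exists_norm_le_grad (hd : d = 2 ∨ d = 3) (hb : Bornology.IsBounded Ω) :
    ∃ C : ℝ, ∀ v : X Ω, ‖v‖ ≤ C * ‖grad v‖ := by
  obtain ⟨C, hC⟩ := exists_eLpNorm_vel_le (Ω := Ω) hd hb (q := 2) (by norm_num) (by norm_num)
  refine ⟨C + 1, fun v => ?_⟩
  have h : ‖vel v‖ₑ ≤ C * ‖grad v‖ₑ := by
    rw [Lp.enorm_def]; exact_mod_cast hC v
  have h' : ‖vel v‖ ≤ C * ‖grad v‖ := by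
    have h2 : ‖vel v‖₊ ≤ C * ‖grad v‖₊ := by
      rw [enorm_eq_nnnorm, enorm_eq_nnnorm] at h
      exact_mod_cast h
    exact_mod_cast h2
  linarith [norm_le_vel_add_grad v]

/-! ### The trilinear form -/

/-- Hölder's inequality with exponents `4, 2, 4`. -/
lemma integrable_mul_mul_and_abs_integral_le {α : Type*} [MeasurableSpace α] {μ : Measure α}
    {a b c : α → ℝ} (ha : MemLp a 4 μ) (hb : MemLp b 2 μ) (hc : MemLp c 4 μ) :
    Integrable (fun x => a x * b x * c x) μ ∧
      |∫ x, a x * b x * c x ∂μ| ≤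
        (eLpNorm a 4 μ).toReal * (eLpNorm b 2 μ).toReal * (eLpNorm c 4 μ).toReal := by
  have i442 : ENNReal.HolderTriple 4 4 2 := ⟨by
    rw [← ENNReal.toReal_eq_toReal_iff' (by simp) (by simp),
      ENNReal.toReal_add (by simp) (by simp)]
    norm_num⟩
  have i221 : ENNReal.HolderTriple 2 2 1 := inferInstance
  have hac : MemLp (a • c) 2 μ := MemLp.smul (p := 4) (q := 4) hc ha
  have hacb : MemLp ((a • c) • b) 1 μ := MemLp.smul (p := 2) (q := 2) hb hac
  have e : (fun x => a x * b x * c x) = (a • c) • b := by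
    funext x
    simp only [Pi.smul_apply', smul_eq_mul, Pi.mul_apply]
    ring
  have h1 : eLpNorm ((a • c) • b) 1 μ ≤ eLpNorm a 4 μ * eLpNorm c 4 μ * eLpNorm b 2 μ :=
    (eLpNorm_smul_le_mul_eLpNorm (p := 2) (q := 2) hb.1 hac.1).trans
      (mul_le_mul_left (eLpNorm_smul_le_mul_eLpNorm (p := 4) (q := 4) hc.1 ha.1) _)
  refine ⟨e ▸ memLp_one_iff_integrable.1 hacb, ?_⟩
  rw [show (∫ x, a x * b x * c x ∂μ) = ∫ x, ((a • c) • b) x ∂μ by rw [← e], ← Real.norm_eq_abs,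
    ← toReal_enorm]
  have h2 : ‖∫ x, ((a • c) • b) x ∂μ‖ₑ ≤ eLpNorm a 4 μ * eLpNorm c 4 μ * eLpNorm b 2 μ := by
    refine (enorm_integral_le_lintegral_enorm _).trans ?_
    rw [← eLpNorm_one_eq_lintegral_enorm]
    exact h1
  refine (ENNReal.toReal_mono (ENNReal.mul_ne_top (ENNReal.mul_ne_top ha.2.ne hc.2.ne) hb.2.ne)
    h2).trans (le_of_eq ?_)
  rw [ENNReal.toReal_mul, ENNReal.toReal_mul]
  ring

/-- `C` is a constant for the embedding of `X` into `L⁴`. -/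
def IsSobolevConst (Ω : Set (Vec d)) (C : NNReal) : Prop :=
  ∀ v : X Ω, eLpNorm (vel v) 4 (vol Ω) ≤ C * ‖grad v‖ₑ

lemma exists_isSobolevConst (hd : d = 2 ∨ d = 3) (hb : Bornology.IsBounded Ω) :
    ∃ C, IsSobolevConst Ω C := by
  obtain ⟨C, hC⟩ := exists_eLpNorm_vel_le (Ω := Ω) hd hb (q := 4) (by norm_num) le_rfl
  exact ⟨C, fun v => by exact_mod_cast hC v⟩

lemma IsSobolevConst.memLp_vel {C : NNReal} (hC : IsSobolevConst Ω C) (v : X Ω) (i : Fin d) :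
    MemLp (fun x => vel v x i) 4 (vol Ω) ∧
      (eLpNorm (fun x => vel v x i) 4 (vol Ω)).toReal ≤ C * ‖grad v‖ := by
  have htop : (C * ‖grad v‖ₑ : ℝ≥0∞) ≠ ⊤ := ENNReal.mul_ne_top ENNReal.coe_ne_top enorm_ne_top
  have hle : eLpNorm (fun x => vel v x i) 4 (vol Ω) ≤ C * ‖grad v‖ₑ :=
    (eLpNorm_mono fun x => PiLp.norm_apply_le (vel v x) i).trans (hC v)
  refine ⟨⟨?_, hle.trans_lt htop.lt_top⟩, ?_⟩
  · exact (EuclideanSpace.proj (𝕜 := ℝ) i).continuous.comp_aestronglyMeasurable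
      (Lp.aestronglyMeasurable (vel v))
  · refine (ENNReal.toReal_mono htop hle).trans (le_of_eq ?_)
    rw [ENNReal.toReal_mul, toReal_enorm, ENNReal.coe_toReal]

lemma memLp_grad (v : X Ω) (p : Fin d × Fin d) :
    MemLp (fun x => grad v x p) 2 (vol Ω) ∧
      (eLpNorm (fun x => grad v x p) 2 (vol Ω)).toReal ≤ ‖grad v‖ := by
  have hle : eLpNorm (fun x => grad v x p) 2 (vol Ω) ≤ ‖grad v‖ₑ := by
    rw [Lp.enorm_def]
    exact eLpNorm_mono fun x => PiLp.norm_apply_le (grad v x) p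
  refine ⟨⟨?_, hle.trans_lt enorm_lt_top⟩, ?_⟩
  · exact (EuclideanSpace.proj (𝕜 := ℝ) p).continuous.comp_aestronglyMeasurable
      (Lp.aestronglyMeasurable (grad v))
  · exact (ENNReal.toReal_mono enorm_ne_top hle).trans (le_of_eq (toReal_enorm _))

lemma IsSobolevConst.integrable_mul_mul {C : NNReal} (hC : IsSobolevConst Ω C)
    (v w χ : X Ω) (i : Fin d) (p : Fin d × Fin d)
    (j : Fin d) : Integrable (fun x => vel v x i * grad w x p * vel χ x j) (vol Ω) :=
  (integrable_mul_mul_and_abs_integral_le (hC.memLp_vel v i).1 (memLp_grad w p).1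
    (hC.memLp_vel χ j).1).1

lemma vel_add_ae (v w : X Ω) : ∀ᵐ x ∂(vol Ω), ∀ i, vel (v + w) x i = vel v x i + vel w x i := by
  filter_upwards [Lp.coeFn_add (vel v) (vel w)] with x hx i
  rw [vel_add, hx]; rfl

lemma vel_smul_ae (c : ℝ) (v : X Ω) : ∀ᵐ x ∂(vol Ω), ∀ i, vel (c • v) x i = c * vel v x i := by
  filter_upwards [Lp.coeFn_smul c (vel v)] with x hx i
  rw [vel_smul, hx]; rfl

lemma grad_add_ae (v w : X Ω) :
    ∀ᵐ x ∂(vol Ω), ∀ p, grad (v + w) x p = grad v x p + grad w x p := by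
  filter_upwards [Lp.coeFn_add (grad v) (grad w)] with x hx p
  rw [grad_add, hx]; rfl

lemma grad_smul_ae (c : ℝ) (v : X Ω) :
    ∀ᵐ x ∂(vol Ω), ∀ p, grad (c • v) x p = c * grad v x p := by
  filter_upwards [Lp.coeFn_smul c (grad v)] with x hx p
  rw [grad_smul, hx]; rfl

/-- The trilinear form `(v, w, χ) ↦ ∫ vᵢ (∇w)ₚ χⱼ`, the building block of the convective term. -/
def componentForm {C : NNReal} (hC : IsSobolevConst Ω C) (i : Fin d) (p : Fin d × Fin d)
    (j : Fin d) : X Ω →ₗ[ℝ] X Ω →ₗ[ℝ] X Ω →ₗ[ℝ] ℝ :=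
  LinearMap.mk₂ ℝ
    (fun v w =>
      { toFun := fun χ => ∫ x, vel v x i * grad w x p * vel χ x j ∂(vol Ω)
        map_add' := fun χ ψ => by
          rw [← integral_add (hC.integrable_mul_mul v w χ i p j)
            (hC.integrable_mul_mul v w ψ i p j)]
          refine integral_congr_ae ?_
          filter_upwards [vel_add_ae χ ψ] with x hx
          rw [hx]; ring
        map_smul' := fun c χ => by
          rw [RingHom.id_apply, smul_eq_mul, ← integral_const_mul]
          refine integral_congr_ae ?_
          filter_upwards [vel_smul_ae c χ] with x hx
          rw [hx]; ring })
    (fun v v' w => by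
      ext χ
      change ∫ x, vel (v + v') x i * grad w x p * vel χ x j ∂(vol Ω) =
        (∫ x, vel v x i * grad w x p * vel χ x j ∂(vol Ω)) +
          ∫ x, vel v' x i * grad w x p * vel χ x j ∂(vol Ω)
      rw [← integral_add (hC.integrable_mul_mul v w χ i p j)
        (hC.integrable_mul_mul v' w χ i p j)]
      refine integral_congr_ae ?_
      filter_upwards [vel_add_ae v v'] with x hx
      rw [hx]; ring)
    (fun c v w => by
      ext χ
      change ∫ x, vel (c • v) x i * grad w x p * vel χ x j ∂(vol Ω) =
        c * ∫ x, vel v x i * grad w x p * vel χ x j ∂(vol Ω)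
      rw [← integral_const_mul]
      refine integral_congr_ae ?_
      filter_upwards [vel_smul_ae c v] with x hx
      rw [hx]; ring)
    (fun v w w' => by
      ext χ
      change ∫ x, vel v x i * grad (w + w') x p * vel χ x j ∂(vol Ω) =
        (∫ x, vel v x i * grad w x p * vel χ x j ∂(vol Ω)) +
          ∫ x, vel v x i * grad w' x p * vel χ x j ∂(vol Ω)
      rw [← integral_add (hC.integrable_mul_mul v w χ i p j)
        (hC.integrable_mul_mul v w' χ i p j)]
      refine integral_congr_ae ?_
      filter_upwards [grad_add_ae w w'] with x hx
      rw [hx]; ring)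
    (fun c v w => by
      ext χ
      change ∫ x, vel v x i * grad (c • w) x p * vel χ x j ∂(vol Ω) =
        c * ∫ x, vel v x i * grad w x p * vel χ x j ∂(vol Ω)
      rw [← integral_const_mul]
      refine integral_congr_ae ?_
      filter_upwards [grad_smul_ae c w] with x hx
      rw [hx]; ring)

section

variable {C : NNReal} (hC : IsSobolevConst Ω C)

lemma componentForm_apply (i : Fin d) (p : Fin d × Fin d) (j : Fin d) (v w χ : X Ω) :
    componentForm hC i p j v w χ = ∫ x, vel v x i * grad w x p * vel χ x j ∂(vol Ω) := rfl

lemma abs_componentForm_le (i : Fin d) (p : Fin d × Fin d) (j : Fin d) (v w χ : X Ω) :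
    |componentForm hC i p j v w χ| ≤ (C : ℝ) ^ 2 * ‖grad v‖ * ‖grad w‖ * ‖grad χ‖ := by
  have hv := hC.memLp_vel v i
  have hw := memLp_grad w p
  have hχ := hC.memLp_vel χ j
  refine (integrable_mul_mul_and_abs_integral_le hv.1 hw.1 hχ.1).2.trans ?_
  calc _ ≤ (C * ‖grad v‖) * ‖grad w‖ * (C * ‖grad χ‖) := by
        gcongr
        exacts [hv.2, hw.2, hχ.2]
    _ = _ := by ring

lemma conv_eq_sum (v w χ : X Ω) :
    conv v w χ = ∑ i, ∑ j, componentForm hC j (i, j) i v w χ := by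
  simp only [componentForm_apply]
  rw [conv, integral_finsetSum _ fun i _ => integrable_finsetSum _ fun j _ =>
    hC.integrable_mul_mul v w χ j (i, j) i]
  exact Finset.sum_congr rfl fun i _ =>
    integral_finsetSum _ fun j _ => hC.integrable_mul_mul v w χ j (i, j) i

/-- The convective term as a trilinear map. -/
def convForm : X Ω →ₗ[ℝ] X Ω →ₗ[ℝ] X Ω →ₗ[ℝ] ℝ := ∑ i, ∑ j, componentForm hC j (i, j) i

lemma convForm_apply (v w χ : X Ω) : convForm hC v w χ = conv v w χ := by
  simp [convForm, conv_eq_sum hC, LinearMap.sum_apply]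

end

lemma IsSobolevConst.exists_abs_conv_le {C : NNReal} (hC : IsSobolevConst Ω C) :
    ∃ K : ℝ, ∀ v w χ : X Ω, |conv v w χ| ≤ K * (‖grad v‖ * ‖grad w‖ * ‖grad χ‖) := by
  refine ⟨∑ _i : Fin d, ∑ _j : Fin d, (C : ℝ) ^ 2, fun v w χ => ?_⟩
  rw [conv_eq_sum hC, Finset.sum_mul]
  refine (Finset.abs_sum_le_sum_abs _ _).trans (Finset.sum_le_sum fun i _ => ?_)
  rw [Finset.sum_mul]
  refine (Finset.abs_sum_le_sum_abs _ _).trans (Finset.sum_le_sum fun j _ => ?_)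
  refine (abs_componentForm_le hC _ _ _ v w χ).trans (le_of_eq (by ring))

/-! ### Integration by parts and skew-symmetry -/

/-- The product rule for `a b c`, integrated over the whole space. -/
lemma integral_partial_mul_mul_eq_zero {a b c : Vec d → ℝ} (e : Vec d)
    (ha : ContDiff ℝ ∞ a) (hb : ContDiff ℝ ∞ b) (hc : ContDiff ℝ ∞ c)
    (sa : HasCompactSupport a) (sc : HasCompactSupport c) :
    (∫ x, a x * fderiv ℝ b x e * c x) + (∫ x, a x * fderiv ℝ c x e * b x) +
      ∫ x, b x * fderiv ℝ a x e * c x = 0 := by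
  have da := ha.differentiable (by simp)
  have db := hb.differentiable (by simp)
  have dc := hc.differentiable (by simp)
  have ca : Continuous fun x => fderiv ℝ a x e :=
    (ha.continuous_fderiv (by simp)).clm_apply continuous_const
  have cb : Continuous fun x => fderiv ℝ b x e :=
    (hb.continuous_fderiv (by simp)).clm_apply continuous_const
  have cc : Continuous fun x => fderiv ℝ c x e :=
    (hc.continuous_fderiv (by simp)).clm_apply continuous_const
  have hab (x) : fderiv ℝ (fun x => a x * b x) x e
      = a x * fderiv ℝ b x e + b x * fderiv ℝ a x e := by
    rw [fderiv_fun_mul (da x) (db x)]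
    simp
  have i1 : Integrable (fun x => a x * fderiv ℝ b x e * c x) :=
    ((ha.continuous.mul cb).mul hc.continuous).integrable_of_hasCompactSupport sc.mul_left
  have i2 : Integrable (fun x => b x * fderiv ℝ a x e * c x) :=
    ((hb.continuous.mul ca).mul hc.continuous).integrable_of_hasCompactSupport sc.mul_left
  have i3 : Integrable (fun x => (a x * b x) * fderiv ℝ c x e) :=
    ((ha.continuous.mul hb.continuous).mul cc).integrable_of_hasCompactSupport
      (sa.mul_right.mul_right)
  have i4 : Integrable (fun x => (a x * b x) * c x) :=
    ((ha.continuous.mul hb.continuous).mul hc.continuous).integrable_of_hasCompactSupport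
      sc.mul_left
  have e1 : (fun x => fderiv ℝ (fun x => a x * b x) x e * c x)
      = fun x => a x * fderiv ℝ b x e * c x + b x * fderiv ℝ a x e * c x := by
    funext x; rw [hab]; ring
  have key := integral_mul_fderiv_eq_neg_fderiv_mul_of_integrable
    (μ := (volume : Measure (Vec d))) (f := fun x => a x * b x) (g := c) (v := e)
    (by rw [e1]; exact i1.add i2) i3 i4 (fun x _ => (da x).mul (db x)) (fun x _ => dc x)
  rw [e1, integral_add i1 i2] at key
  have e2 : (∫ x, a x * fderiv ℝ c x e * b x) = ∫ x, (a x * b x) * fderiv ℝ c x e :=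
    integral_congr_ae (Filter.Eventually.of_forall fun x => by ring)
  rw [e2, key]
  ring

lemma integral_partial_eq_zero {a : Vec d → ℝ} (e : Vec d)
    (ha : ContDiff ℝ ∞ a) (sa : HasCompactSupport a) : ∫ x, fderiv ℝ a x e = 0 := by
  have ca : Continuous fun x => fderiv ℝ a x e :=
    (ha.continuous_fderiv (by simp)).clm_apply continuous_const
  have key := integral_mul_fderiv_eq_neg_fderiv_mul_of_integrable
    (μ := (volume : Measure (Vec d))) (f := fun _ => (1 : ℝ)) (g := a) (v := e)
    (by simp)
    (by simpa using ca.integrable_of_hasCompactSupport (sa.fderiv_apply (𝕜 := ℝ) e))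
    (by simpa using ha.continuous.integrable_of_hasCompactSupport sa)
    (fun x _ => by fun_prop) (fun x _ => ha.differentiable (by simp) x)
  simpa using key

lemma classicalGrad_apply {φ : Vec d → Vec d} (hφ : ContDiff ℝ ∞ φ) (x : Vec d)
    (i j : Fin d) : classicalGrad φ x (i, j)
      = fderiv ℝ (fun y => φ y i) x (EuclideanSpace.single j 1) := by
  have h := ((EuclideanSpace.proj (𝕜 := ℝ) i).hasFDerivAt.comp x
    (hφ.differentiable (by simp) x).hasFDerivAt).fderiv
  have h' : fderiv ℝ (fun y => φ y i) x
      = (EuclideanSpace.proj (𝕜 := ℝ) i).comp (fderiv ℝ φ x) := h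
  rw [h']
  rfl

lemma IsTestField.comp_apply {φ : Vec d → Vec d} (hφ : IsTestField Ω φ) (i : Fin d) :
    ContDiff ℝ ∞ (fun x => φ x i) ∧ HasCompactSupport (fun x => φ x i) ∧
      Function.support (fun x => φ x i) ⊆ Ω := by
  refine ⟨(EuclideanSpace.proj (𝕜 := ℝ) i).contDiff.comp hφ.smooth,
    hφ.compact.comp_left (g := fun y : Vec d => y i) rfl, fun x hx => ?_⟩
  refine hφ.support (subset_tsupport φ fun h0 => hx ?_)
  simp [h0]

section

variable {C : NNReal} (hC : IsSobolevConst Ω C)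

lemma componentForm_testField {v w χ : X Ω} {φ ψ η : Vec d → Vec d}
    (hφ : (vel v) =ᵐ[vol Ω] φ) (hψ : (grad w) =ᵐ[vol Ω] classicalGrad ψ)
    (hη : (vel χ) =ᵐ[vol Ω] η) (tφ : IsTestField Ω φ) (tψ : IsTestField Ω ψ)
    (i j k l : Fin d) :
    componentForm hC i (k, l) j v w χ =
      ∫ x, φ x i * fderiv ℝ (fun y => ψ y k) x (EuclideanSpace.single l 1) * η x j := by
  rw [componentForm_apply]
  have : (∫ x, vel v x i * grad w x (k, l) * vel χ x j ∂(vol Ω)) =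
      ∫ x in Ω, φ x i * fderiv ℝ (fun y => ψ y k) x (EuclideanSpace.single l 1) * η x j := by
    refine integral_congr_ae ?_
    filter_upwards [hφ, hψ, hη] with x h1 h2 h3
    rw [h1, h2, h3, classicalGrad_apply tψ.smooth]
  rw [this]
  refine setIntegral_eq_integral_of_forall_compl_eq_zero fun x hx => ?_
  have h0 : φ x i = 0 := by
    by_contra h
    exact hx ((tφ.comp_apply i).2.2 h)
  simp [h0]

/-- The product rule `∂ⱼ(vⱼ wᵢ χᵢ) = …`, integrated over `Ω`. It holds for test fields and extends
to `X` one variable at a time, by density. -/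
lemma componentForm_add_add_eq_zero (i j : Fin d) (v w χ : X Ω) :
    componentForm hC j (i, j) i v w χ + componentForm hC j (i, j) i v χ w +
      componentForm hC i (j, j) i w v χ = 0 := by
  have hbd : ∀ v w χ : X Ω,
      |componentForm hC j (i, j) i v w χ + componentForm hC j (i, j) i v χ w +
        componentForm hC i (j, j) i w v χ| ≤ 3 * (C : ℝ) ^ 2 * ‖v‖ * ‖w‖ * ‖χ‖ := by
    intro v w χ
    have hv := norm_grad_le v
    have hw := norm_grad_le w
    have hχ := norm_grad_le χ
    have hb : (C : ℝ) ^ 2 * ‖grad v‖ * ‖grad w‖ * ‖grad χ‖ ≤ (C : ℝ) ^ 2 * ‖v‖ * ‖w‖ * ‖χ‖ := by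
      gcongr
    have h1 := abs_componentForm_le hC j (i, j) i v w χ
    have h2 := abs_componentForm_le hC j (i, j) i v χ w
    have h3 := abs_componentForm_le hC i (j, j) i w v χ
    refine (abs_add_three _ _ _).trans ?_
    nlinarith
  -- All three arguments are test fields.
  have h0 : ∀ v ∈ testSet Ω, ∀ w ∈ testSet Ω, ∀ χ ∈ testSet Ω,
      componentForm hC j (i, j) i v w χ + componentForm hC j (i, j) i v χ w +
        componentForm hC i (j, j) i w v χ = 0 := by
    rintro v ⟨φ, tφ, h1, h2⟩ w ⟨ψ, tψ, h3, h4⟩ χ ⟨η, tη, h5, h6⟩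
    rw [componentForm_testField hC h1 h4 h5 tφ tψ, componentForm_testField hC h1 h6 h3 tφ tη,
      componentForm_testField hC h3 h2 h5 tψ tφ]
    exact integral_partial_mul_mul_eq_zero _ (tφ.comp_apply j).1 (tψ.comp_apply i).1
      (tη.comp_apply i).1 (tφ.comp_apply j).2.1 (tη.comp_apply i).2.1
  have h1 : ∀ v ∈ testSet Ω, ∀ w ∈ testSet Ω, ∀ χ,
      componentForm hC j (i, j) i v w χ + componentForm hC j (i, j) i v χ w +
        componentForm hC i (j, j) i w v χ = 0 := fun v hv w hw =>
    eq_zero_of_testSet (componentForm hC j (i, j) i v w + (componentForm hC j (i, j) i v).flip w +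
      componentForm hC i (j, j) i w v) (3 * (C : ℝ) ^ 2 * ‖v‖ * ‖w‖) (fun χ => hbd v w χ)
      (fun χ hχ => h0 v hv w hw χ hχ)
  have h2 : ∀ v ∈ testSet Ω, ∀ χ w,
      componentForm hC j (i, j) i v w χ + componentForm hC j (i, j) i v χ w +
        componentForm hC i (j, j) i w v χ = 0 := fun v hv χ =>
    eq_zero_of_testSet ((componentForm hC j (i, j) i v).flip χ + componentForm hC j (i, j) i v χ +
      ((componentForm hC i (j, j) i).flip v).flip χ) (3 * (C : ℝ) ^ 2 * ‖v‖ * ‖χ‖)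
      (fun w => (hbd v w χ).trans (le_of_eq (by ring)))
      (fun w hw => h1 v hv w hw χ)
  exact eq_zero_of_testSet (((componentForm hC j (i, j) i).flip w).flip χ +
      ((componentForm hC j (i, j) i).flip χ).flip w + (componentForm hC i (j, j) i w).flip χ)
      (3 * (C : ℝ) ^ 2 * ‖w‖ * ‖χ‖)
      (fun v => (hbd v w χ).trans (le_of_eq (by ring))) (fun v hv => h2 v hv χ w) v

end

lemma div_ae (v : X Ω) : ∀ᵐ x ∂(vol Ω), div v x = ∑ i, grad v x (i, i) := by
  filter_upwards [(traceCLM d).coeFn_compLp (grad v)] with x hx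
  rw [div, hx]
  simp [traceCLM]

/-- The divergence theorem for fields vanishing on the boundary. -/
lemma integral_div_eq_zero (hb : Bornology.IsBounded Ω) (v : X Ω) :
    ∫ x, div v x ∂(vol Ω) = 0 := by
  have : IsFiniteMeasure (vol Ω) := isFiniteMeasure_vol hb
  have hinner (v : X Ω) : inner ℝ (Lp.const 2 (vol Ω) (1 : ℝ)) (div v) = ∫ x, div v x ∂(vol Ω) := by
    rw [L2.inner_def]
    refine integral_congr_ae ?_
    filter_upwards [Lp.coeFn_const (p := 2) (μ := vol Ω) (1 : ℝ)] with x hx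
    rw [hx]
    simp
  let gradL : X Ω →L[ℝ] Lp (Mat d) 2 (vol Ω) := ⟨⟨⟨grad, grad_add⟩, grad_smul⟩, continuous_grad⟩
  let L : X Ω →L[ℝ] ℝ :=
    (innerSL ℝ (Lp.const 2 (vol Ω) (1 : ℝ))).comp (((traceCLM d).compLpL 2 (vol Ω)).comp gradL)
  have hL (v : X Ω) : L v = ∫ x, div v x ∂(vol Ω) := hinner v
  rw [← hL]
  refine eq_zero_of_testSet L.toLinearMap ‖L‖ (fun v => L.le_opNorm v) ?_ v
  rintro w ⟨φ, tφ, h1, h2⟩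
  change L w = 0
  rw [hL]
  have e1 : ∫ x, div w x ∂(vol Ω) = ∫ x in Ω,
      ∑ i, fderiv ℝ (fun y => φ y i) x (EuclideanSpace.single i 1) := by
    refine integral_congr_ae ?_
    have h2' : grad w =ᵐ[vol Ω] classicalGrad φ := h2
    filter_upwards [div_ae w, h2'] with x hx hx2
    rw [hx, hx2]
    exact Finset.sum_congr rfl fun i _ => classicalGrad_apply tφ.smooth x i i
  rw [e1, setIntegral_eq_integral_of_forall_compl_eq_zero, integral_finsetSum]
  · exact Finset.sum_eq_zero fun i _ =>
      integral_partial_eq_zero _ (tφ.comp_apply i).1 (tφ.comp_apply i).2.1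
  · intro i _
    exact (((tφ.comp_apply i).1.continuous_fderiv (by simp)).clm_apply
      continuous_const).integrable_of_hasCompactSupport ((tφ.comp_apply i).2.1.fderiv_apply ℝ _)
  · intro x hx
    refine Finset.sum_eq_zero fun i _ => ?_
    rw [← classicalGrad_apply tφ.smooth]
    have : classicalGrad φ x = 0 := by
      by_contra h
      exact hx (tφ.support (support_classicalGrad_subset φ h))
    simp [this]

/-- As `∇ · v` itself has mean zero, testing with `q = ∇ · v` shows that it vanishes. -/
lemma div_eq_zero (hb : Bornology.IsBounded Ω) (v : V Ω) : div (v : X Ω) = 0 :=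
  inner_self_eq_zero.1 (v.2 (div (v : X Ω)) (integral_div_eq_zero hb v))

lemma conv_skew (hb : Bornology.IsBounded Ω) {C : NNReal} (hC : IsSobolevConst Ω C) (v : V Ω)
    (w χ : X Ω) : conv (v : X Ω) w χ + conv (v : X Ω) χ w = 0 := by
  have h0 : ∑ i, ∑ j, componentForm hC i (j, j) i w v χ = 0 := by
    refine Finset.sum_eq_zero fun i _ => ?_
    simp only [componentForm_apply]
    rw [← integral_finsetSum _ fun j _ => hC.integrable_mul_mul w v χ i (j, j) i]
    refine integral_eq_zero_of_ae ?_
    have hz : div (v : X Ω) =ᵐ[vol Ω] 0 := by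
      rw [div_eq_zero hb v]; exact Lp.coeFn_zero _ _ _
    filter_upwards [div_ae (v : X Ω), hz] with x h1 h2
    rw [← Finset.sum_mul, ← Finset.mul_sum, ← h1, h2]
    simp
  have hs : ∑ i, ∑ j, (componentForm hC j (i, j) i (v : X Ω) w χ +
      componentForm hC j (i, j) i (v : X Ω) χ w + componentForm hC i (j, j) i w v χ) = 0 :=
    Finset.sum_eq_zero fun i _ => Finset.sum_eq_zero fun j _ =>
      componentForm_add_add_eq_zero hC i j v w χ
  simp only [Finset.sum_add_distrib] at hs
  rw [conv_eq_sum hC, conv_eq_sum hC]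
  linarith

lemma conv_self (hb : Bornology.IsBounded Ω) {C : NNReal} (hC : IsSobolevConst Ω C) (v : V Ω)
    (w : X Ω) : conv (v : X Ω) w w = 0 := by
  linarith [conv_skew hb hC v w w]

/-! ### Dual norms -/

lemma IsSobolevConst.abs_conv_le {C : NNReal} (hC : IsSobolevConst Ω C) {M : ℝ}
    (hM : convConst Ω ≤ M) (v w χ : V Ω) : |conv (v : X Ω) w χ| ≤
      M * (‖grad (v : X Ω)‖ * ‖grad (w : X Ω)‖ * ‖grad (χ : X Ω)‖) := by
  obtain ⟨K, hK⟩ := hC.exists_abs_conv_le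
  -- The supremum defining `convConst` is over a bounded set, hence is not a junk value.
  have hbdd : BddAbove (Set.range fun p : V Ω × V Ω × V Ω =>
      conv (p.1 : X Ω) p.2.1 p.2.2 /
        (‖grad (p.1 : X Ω)‖ * ‖grad (p.2.1 : X Ω)‖ * ‖grad (p.2.2 : X Ω)‖)) := by
    refine ⟨max K 0, ?_⟩
    rintro _ ⟨p, rfl⟩
    refine div_le_of_le_mul₀ (by positivity) (le_max_right _ _) ?_
    refine (le_abs_self _).trans ((hK _ _ _).trans ?_)
    exact mul_le_mul_of_nonneg_right (le_max_left _ _) (by positivity)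
  have key (χ : V Ω) : conv (v : X Ω) w χ ≤
      M * (‖grad (v : X Ω)‖ * ‖grad (w : X Ω)‖ * ‖grad (χ : X Ω)‖) := by
    have h0 : 0 ≤ ‖grad (v : X Ω)‖ * ‖grad (w : X Ω)‖ * ‖grad (χ : X Ω)‖ := by positivity
    rcases h0.eq_or_lt with h | h
    · have := (le_abs_self _).trans (hK v w χ)
      rw [← h] at this ⊢
      simpa using this
    · rw [← div_le_iff₀ h]
      exact (le_ciSup hbdd (v, w, χ)).trans hM
  refine abs_le.2 ⟨?_, key χ⟩
  have hneg := key (-χ)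
  rw [← convForm_apply hC, Submodule.coe_neg, map_neg, convForm_apply hC, grad_neg,
    norm_neg] at hneg
  linarith

lemma le_normNegOne_mul (hd : d = 2 ∨ d = 3) (hb : Bornology.IsBounded Ω) (f : HNegOne Ω)
    (χ : X Ω) : f χ ≤ normNegOne f * ‖grad χ‖ := by
  obtain ⟨C, hC⟩ := exists_norm_le_grad (Ω := Ω) hd hb
  have hK (χ : X Ω) : f χ ≤ ‖f‖ * max C 0 * ‖grad χ‖ := by
    refine (le_abs_self _).trans ((f.le_opNorm χ).trans ?_)
    rw [mul_assoc]
    exact mul_le_mul_of_nonneg_left ((hC χ).trans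
      (mul_le_mul_of_nonneg_right (le_max_left _ _) (norm_nonneg _))) (norm_nonneg f)
  have hbdd : BddAbove (Set.range fun χ : {χ : X Ω // χ ≠ 0} => f χ / ‖grad χ.1‖) := by
    refine ⟨‖f‖ * max C 0, ?_⟩
    rintro _ ⟨χ, rfl⟩
    exact div_le_of_le_mul₀ (norm_nonneg _) (by positivity) (hK χ)
  rcases (norm_nonneg (grad χ)).eq_or_lt with h | h
  · have := hK χ
    rw [← h] at this ⊢
    rwa [mul_zero] at this ⊢
  · have hχ : χ ≠ 0 := by
      rintro rfl
      simp [grad_zero] at h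
    rw [← div_le_iff₀ h]
    exact le_ciSup hbdd ⟨χ, hχ⟩

lemma normNegOne_nonneg (f : HNegOne Ω) : 0 ≤ normNegOne f := by
  by_cases hbdd : BddAbove (Set.range fun χ : {χ : X Ω // χ ≠ 0} => f χ / ‖grad χ.1‖)
  · rcases isEmpty_or_nonempty {χ : X Ω // χ ≠ 0} with he | ⟨⟨χ, hχ⟩⟩
    · exact (Real.iSup_of_isEmpty _).ge
    · have h1 : f χ / ‖grad χ‖ ≤ normNegOne f := le_ciSup hbdd ⟨χ, hχ⟩
      have h2 : f (-χ) / ‖grad (-χ)‖ ≤ normNegOne f := le_ciSup hbdd ⟨-χ, neg_ne_zero.2 hχ⟩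
      rw [map_neg, grad_neg, norm_neg, neg_div] at h2
      linarith
  · exact (Real.sSup_of_not_bddAbove hbdd).ge

lemma normV'_le {φ : V Ω → ℝ} {K : ℝ} (hK0 : 0 ≤ K)
    (hK : ∀ χ, φ χ ≤ K * ‖grad (χ : X Ω)‖) : normV' φ ≤ K :=
  Real.iSup_le (fun χ => div_le_of_le_mul₀ (norm_nonneg _) hK0 (hK χ)) hK0

lemma le_normV'_mul {φ : V Ω → ℝ} (hφ : ∃ K, ∀ χ, φ χ ≤ K * ‖grad (χ : X Ω)‖) (χ : V Ω) :
    φ χ ≤ normV' φ * ‖grad (χ : X Ω)‖ := by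
  obtain ⟨K, hK⟩ := hφ
  have hbdd : BddAbove (Set.range fun χ : {χ : V Ω // χ ≠ 0} =>
      φ χ / ‖grad (χ.1 : X Ω)‖) := by
    refine ⟨max K 0, ?_⟩
    rintro _ ⟨χ, rfl⟩
    refine div_le_of_le_mul₀ (norm_nonneg _) (le_max_right _ _) ((hK χ).trans ?_)
    exact mul_le_mul_of_nonneg_right (le_max_left _ _) (norm_nonneg _)
  rcases (norm_nonneg (grad (χ : X Ω))).eq_or_lt with h | h
  · have := hK χ
    rw [← h] at this ⊢
    rwa [mul_zero] at this ⊢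
  · have hχ : χ ≠ 0 := by
      rintro rfl
      simp [grad_zero] at h
    rw [← div_le_iff₀ h]
    exact le_ciSup hbdd ⟨χ, hχ⟩

lemma normV'_nonneg {φ : V Ω → ℝ} (hφ : ∀ χ, φ (-χ) = -φ χ) : 0 ≤ normV' φ := by
  by_cases hbdd : BddAbove (Set.range fun χ : {χ : V Ω // χ ≠ 0} => φ χ / ‖grad (χ.1 : X Ω)‖)
  · rcases isEmpty_or_nonempty {χ : V Ω // χ ≠ 0} with he | ⟨⟨χ, hχ⟩⟩
    · exact (Real.iSup_of_isEmpty _).ge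
    · have h1 : φ χ / ‖grad (χ : X Ω)‖ ≤ normV' φ := le_ciSup hbdd ⟨χ, hχ⟩
      have h2 : φ (-χ) / ‖grad ((-χ : V Ω) : X Ω)‖ ≤ normV' φ :=
        le_ciSup hbdd ⟨-χ, neg_ne_zero.2 hχ⟩
      rw [hφ, Submodule.coe_neg, grad_neg, norm_neg, neg_div] at h2
      linarith
  · exact (Real.sSup_of_not_bddAbove hbdd).ge

/-! ### Residuals and increments of the Picard iteration -/

/-- The properties of the convective term on `V` on which the convergence analysis rests:
trilinearity, continuity with constant `M` and skew-symmetry. -/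
structure IsConvective (Ω : Set (Vec d)) (M : ℝ) : Prop where
  exists_form : ∃ b : X Ω →ₗ[ℝ] X Ω →ₗ[ℝ] X Ω →ₗ[ℝ] ℝ, ∀ v w χ, conv v w χ = b v w χ
  abs_le : ∀ v w χ : V Ω, |conv (v : X Ω) w χ| ≤
    M * (‖grad (v : X Ω)‖ * ‖grad (w : X Ω)‖ * ‖grad (χ : X Ω)‖)
  self_eq_zero : ∀ v w : V Ω, conv (v : X Ω) w w = 0

lemma isConvective (hd : d = 2 ∨ d = 3) (hb : Bornology.IsBounded Ω) {M : ℝ}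
    (hM : convConst Ω ≤ M) : IsConvective Ω M := by
  obtain ⟨C, hC⟩ := exists_isSobolevConst (Ω := Ω) hd hb
  exact ⟨⟨convForm hC, fun v w χ => (convForm_apply hC v w χ).symm⟩,
    hC.abs_conv_le hM, fun v w => conv_self hb hC v w⟩

/-- The triple of zeros contributes `0 / 0 = 0` to the supremum. -/
lemma convConst_nonneg : 0 ≤ convConst Ω := by
  by_cases hbdd : BddAbove (Set.range fun p : V Ω × V Ω × V Ω =>
      conv (p.1 : X Ω) p.2.1 p.2.2 /
        (‖grad (p.1 : X Ω)‖ * ‖grad (p.2.1 : X Ω)‖ * ‖grad (p.2.2 : X Ω)‖))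
  · refine le_trans (le_of_eq ?_) (le_ciSup hbdd (0, 0, 0))
    simp [grad_zero]
  · exact (Real.sSup_of_not_bddAbove hbdd).ge

lemma kappa_nonneg {M : ℝ} (hM : 0 ≤ M) (ν : ℝ) (f : HNegOne Ω) : 0 ≤ kappa M ν f :=
  mul_nonneg (mul_nonneg hM (by positivity)) (normNegOne_nonneg f)

section

variable {M ν : ℝ} (hM : 0 ≤ M) (hν : 0 < ν) {f : HNegOne Ω} (B : IsConvective Ω M)

include B in
lemma IsConvective.conv_sub_left (v v' w χ : X Ω) :
    conv (v - v') w χ = conv v w χ - conv v' w χ := by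
  obtain ⟨b, hb⟩ := B.exists_form
  simp only [hb, map_sub, LinearMap.sub_apply]

include B in
lemma IsConvective.conv_sub_mid (v w w' χ : X Ω) :
    conv v (w - w') χ = conv v w χ - conv v w' χ := by
  obtain ⟨b, hb⟩ := B.exists_form
  simp only [hb, map_sub, LinearMap.sub_apply]

lemma inner_grad_sub (v w χ : X Ω) : inner ℝ (grad (v - w)) (grad χ) =
    inner ℝ (grad v) (grad χ) - inner ℝ (grad w) (grad χ) := by
  rw [grad_sub, inner_sub_left]

lemma norm_smul_grad_le {F : ℝ} {χ : X Ω} {a : ℝ} (hF : 0 ≤ F)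
    (h : a * ‖grad χ‖ ^ 2 ≤ F * ‖grad χ‖) : a * ‖grad χ‖ ≤ F := by
  rcases (norm_nonneg (grad χ)).eq_or_lt with h0 | h0
  · rw [← h0]; simpa using hF
  · exact le_of_mul_le_mul_right (by linarith [sq ‖grad χ‖]) h0

include B in
lemma g_neg (v χ : V Ω) : g ν f v (-χ) = -g ν f v χ := by
  obtain ⟨b, hb⟩ := B.exists_form
  simp only [g, hb, Submodule.coe_neg, map_neg, grad_neg, inner_neg_right]
  ring

include B in
lemma g_bounded (v : V Ω) (hf : ∀ χ : X Ω, f χ ≤ normNegOne f * ‖grad χ‖) :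
    ∃ K, ∀ χ, g ν f v χ ≤ K * ‖grad (χ : X Ω)‖ := by
  refine ⟨|ν| * ‖grad (v : X Ω)‖ + M * (‖grad (v : X Ω)‖ * ‖grad (v : X Ω)‖) + normNegOne f,
    fun χ => ?_⟩
  have h1 : ν * inner ℝ (grad (v : X Ω)) (grad (χ : X Ω)) ≤
      |ν| * (‖grad (v : X Ω)‖ * ‖grad (χ : X Ω)‖) := by
    refine (le_abs_self _).trans ?_
    rw [abs_mul]
    exact mul_le_mul_of_nonneg_left (abs_real_inner_le_norm _ _) (abs_nonneg _)
  have h2 := (le_abs_self _).trans (B.abs_le v v χ)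
  have h3 := hf (-χ)
  rw [map_neg, grad_neg, norm_neg] at h3
  rw [g]
  linarith

variable (hf : ∀ χ : X Ω, f χ ≤ normNegOne f * ‖grad χ‖) {u w u' w' : V Ω}

include B hf in
/-- The a priori bound for the Picard iterate, obtained by testing with the iterate itself. -/
lemma IsPicard.norm_grad_le (h : IsPicard ν f u w) : ν * ‖grad (w : X Ω)‖ ≤ normNegOne f := by
  refine norm_smul_grad_le (normNegOne_nonneg f) ?_
  have hw := h w
  rw [B.self_eq_zero, real_inner_self_eq_norm_sq, add_zero] at hw
  rw [hw]
  exact hf w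

include B in
lemma IsPicard.g_eq (h : IsPicard ν f u w) (χ : V Ω) :
    g ν f w χ = conv ((w - u : V Ω) : X Ω) w χ := by
  obtain ⟨b, hb⟩ := B.exists_form
  have := h χ
  simp only [g, hb, Submodule.coe_sub, map_sub, LinearMap.sub_apply] at this ⊢
  linarith

include B hf in
/-- The increment of the Picard iteration is controlled by the residual, as is seen by testing the
residual with the increment. -/
lemma IsPicard.norm_grad_sub_le (h : IsPicard ν f u w) :
    ν * ‖grad ((u - w : V Ω) : X Ω)‖ ≤ normV' (g ν f u) := by
  refine norm_smul_grad_le (normV'_nonneg (g_neg B u)) ?_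
  refine le_trans (le_of_eq ?_) (le_normV'_mul (g_bounded B u hf) (u - w))
  have h1 := h (u - w)
  have h2 := B.self_eq_zero u (u - w)
  have h3 : inner ℝ (grad ((u - w : V Ω) : X Ω)) (grad ((u - w : V Ω) : X Ω)) =
      inner ℝ (grad (u : X Ω)) (grad ((u - w : V Ω) : X Ω)) -
        inner ℝ (grad (w : X Ω)) (grad ((u - w : V Ω) : X Ω)) := inner_grad_sub _ _ _
  have h4 : conv (u : X Ω) ((u - w : V Ω) : X Ω) ((u - w : V Ω) : X Ω) =
      conv (u : X Ω) u ((u - w : V Ω) : X Ω) - conv (u : X Ω) w ((u - w : V Ω) : X Ω) :=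
    B.conv_sub_mid _ _ _ _
  rw [← real_inner_self_eq_norm_sq, h3, g]
  generalize u - w = e at *
  linarith

include hM hν B hf in
lemma IsPicard.normV'_g_le (h : IsPicard ν f u w) :
    normV' (g ν f w) ≤ kappa M ν f * normV' (g ν f u) := by
  have hg0 := normV'_nonneg (g_neg (ν := ν) (f := f) B u)
  refine normV'_le (mul_nonneg (kappa_nonneg hM ν f) hg0) fun χ => ?_
  rw [h.g_eq B]
  refine (le_abs_self _).trans ((B.abs_le _ _ _).trans ?_)
  have h1 := h.norm_grad_sub_le B hf
  have h2 := h.norm_grad_le B hf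
  have e : ‖grad ((w - u : V Ω) : X Ω)‖ = ‖grad ((u - w : V Ω) : X Ω)‖ := by
    rw [← neg_sub u w, Submodule.coe_neg, grad_neg, norm_neg]
  have h1' := (le_div_iff₀' hν).2 h1
  have h2' := (le_div_iff₀' hν).2 h2
  rw [e]
  refine (mul_le_mul_of_nonneg_left (mul_le_mul_of_nonneg_right
    (mul_le_mul h1' h2' (norm_nonneg _) (div_nonneg hg0 hν.le)) (norm_nonneg _)) hM).trans
    (le_of_eq ?_)
  rw [kappa]
  field_simp

include B in
/-- The energy identity for the difference of two Picard iterates. -/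
lemma IsPicard.energy_sub (h : IsPicard ν f u w) (h' : IsPicard ν f u' w') :
    ν * ‖grad ((w - w' : V Ω) : X Ω)‖ ^ 2 =
      -conv ((u - u' : V Ω) : X Ω) w' ((w - w' : V Ω) : X Ω) := by
  have h1 := h (w - w')
  have h1' := h' (w - w')
  have h3 := B.self_eq_zero u (w - w')
  have h4 : inner ℝ (grad ((w - w' : V Ω) : X Ω)) (grad ((w - w' : V Ω) : X Ω)) =
      inner ℝ (grad (w : X Ω)) (grad ((w - w' : V Ω) : X Ω)) -
        inner ℝ (grad (w' : X Ω)) (grad ((w - w' : V Ω) : X Ω)) := inner_grad_sub _ _ _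
  have h5 : conv (u : X Ω) ((w - w' : V Ω) : X Ω) ((w - w' : V Ω) : X Ω) =
      conv (u : X Ω) w ((w - w' : V Ω) : X Ω) - conv (u : X Ω) w' ((w - w' : V Ω) : X Ω) :=
    B.conv_sub_mid _ _ _ _
  have h6 : conv ((u - u' : V Ω) : X Ω) w' ((w - w' : V Ω) : X Ω) =
      conv (u : X Ω) w' ((w - w' : V Ω) : X Ω) - conv (u' : X Ω) w' ((w - w' : V Ω) : X Ω) :=
    B.conv_sub_left _ _ _ _
  rw [← real_inner_self_eq_norm_sq, h4, h6]
  linear_combination h1 - h1' - h3 + h5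

include hM hν B hf in
/-- The Picard map is a contraction with factor `κ`. -/
lemma IsPicard.norm_grad_sub_le_kappa_mul (h : IsPicard ν f u w) (h' : IsPicard ν f u' w') :
    ‖grad ((w - w' : V Ω) : X Ω)‖ ≤ kappa M ν f * ‖grad ((u - u' : V Ω) : X Ω)‖ := by
  have hF := normNegOne_nonneg f
  have h2 := (le_div_iff₀' hν).2 (h'.norm_grad_le B hf)
  have key : ν * ‖grad ((w - w' : V Ω) : X Ω)‖ ≤
      M * (‖grad ((u - u' : V Ω) : X Ω)‖ * (normNegOne f / ν)) := by
    refine norm_smul_grad_le (by positivity) ?_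
    rw [h.energy_sub B h']
    refine (neg_le_abs _).trans ((B.abs_le _ _ _).trans ?_)
    rw [mul_assoc M]
    exact mul_le_mul_of_nonneg_left (mul_le_mul_of_nonneg_right
      (mul_le_mul_of_nonneg_left h2 (norm_nonneg _)) (norm_nonneg _)) hM
  have := (le_div_iff₀' hν).2 key
  refine this.trans (le_of_eq ?_)
  rw [kappa]; field_simp

include hM hν B hf in
/-- Adding and subtracting the two Picard iterates in `u - u'` bounds their distance by the two
residuals, as `κ < 1` allows the distance itself to be absorbed. -/
lemma IsPicard.norm_grad_sub_le_residuals (h : IsPicard ν f u w) (h' : IsPicard ν f u' w')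
    (hκ : kappa M ν f < 1) : ‖grad ((w - w' : V Ω) : X Ω)‖ ≤
      kappa M ν f / (ν * (1 - kappa M ν f)) * (normV' (g ν f u) + normV' (g ν f u')) := by
  have hκ0 := kappa_nonneg hM ν f
  have h1 := (le_div_iff₀' hν).2 (h.norm_grad_sub_le B hf)
  have h2 := (le_div_iff₀' hν).2 (h'.norm_grad_sub_le B hf)
  have h3 := h.norm_grad_sub_le_kappa_mul hM hν B hf h'
  have e : ((u - u' : V Ω) : X Ω) = ((u - w : V Ω) : X Ω) + ((w - w' : V Ω) : X Ω)
      - ((u' - w' : V Ω) : X Ω) := by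
    simp only [Submodule.coe_sub]; abel
  have h4 : ‖grad ((u - u' : V Ω) : X Ω)‖ ≤ normV' (g ν f u) / ν +
      ‖grad ((w - w' : V Ω) : X Ω)‖ + normV' (g ν f u') / ν := by
    rw [e, grad_sub, grad_add]
    exact (norm_sub_le _ _).trans
      (add_le_add ((norm_add_le _ _).trans (add_le_add h1 le_rfl)) h2)
  have hpos : 0 < 1 - kappa M ν f := by linarith
  have h5 := h3.trans (mul_le_mul_of_nonneg_left h4 hκ0)
  have h6 : (1 - kappa M ν f) * ‖grad ((w - w' : V Ω) : X Ω)‖ ≤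
      kappa M ν f * ((normV' (g ν f u) + normV' (g ν f u')) / ν) := by
    rw [add_div]; linarith
  refine ((le_div_iff₀' hpos).2 h6).trans (le_of_eq ?_)
  field_simp

include B in
/-- For an affine combination the residual differs from the combination of the residuals by a
term quadratic in the difference. -/
lemma g_affine_comb {a b : ℝ} (hab : a + b = 1) (χ : V Ω) :
    g ν f (a • w' + b • w) χ = (a * g ν f w' χ + b * g ν f w χ) -
      a * b * conv ((w - w' : V Ω) : X Ω) ((w - w' : V Ω) : X Ω) χ := by
  obtain ⟨c, hc⟩ := B.exists_form
  obtain rfl : b = 1 - a := by linarith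
  simp only [g, hc, Submodule.coe_sub, Submodule.coe_add, Submodule.coe_smul, map_sub, map_add,
    map_smul, LinearMap.sub_apply, LinearMap.add_apply, LinearMap.smul_apply, smul_eq_mul,
    grad_add, grad_smul, inner_add_left, real_inner_smul_left]
  ring

include hM B hf in
lemma normV'_g_affine_comb_le {a b A : ℝ} (hab : a + b = 1) (ha : |a| ≤ A) (hb : |b| ≤ A) :
    normV' (g ν f (a • w' + b • w)) ≤ normV' (a • g ν f w' + b • g ν f w) +
      M * A ^ 2 * ‖grad ((w - w' : V Ω) : X Ω)‖ ^ 2 := by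
  set φ : V Ω → ℝ := a • g ν f w' + b • g ν f w with hφ
  have hφ_apply (χ) : φ χ = a * g ν f w' χ + b * g ν f w χ := rfl
  have hφ_neg (χ) : φ (-χ) = -φ χ := by
    simp only [hφ_apply, g_neg B]; ring
  have hcomb (χ : V Ω) := g_affine_comb (ν := ν) (f := f) B (w := w) (w' := w') hab χ
  have hconv (χ : V Ω) :
      |a * b * conv ((w - w' : V Ω) : X Ω) ((w - w' : V Ω) : X Ω) χ| ≤
        M * A ^ 2 * ‖grad ((w - w' : V Ω) : X Ω)‖ ^ 2 * ‖grad (χ : X Ω)‖ := by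
    rw [abs_mul, abs_mul]
    have hA : 0 ≤ A := (abs_nonneg a).trans ha
    refine (mul_le_mul (mul_le_mul ha hb (abs_nonneg _) hA) (B.abs_le _ _ _) (abs_nonneg _)
      (mul_nonneg hA hA)).trans (le_of_eq ?_)
    ring
  have hφ_bdd : ∃ K, ∀ χ, φ χ ≤ K * ‖grad (χ : X Ω)‖ := by
    obtain ⟨K, hK⟩ := g_bounded (ν := ν) B (a • w' + b • w) hf
    refine ⟨K + M * A ^ 2 * ‖grad ((w - w' : V Ω) : X Ω)‖ ^ 2, fun χ => ?_⟩
    have h1 := hK χ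
    rw [hcomb] at h1
    have h2 := (le_abs_self _).trans (hconv χ)
    rw [hφ_apply]
    linarith
  refine normV'_le (add_nonneg (normV'_nonneg hφ_neg) (by positivity)) fun χ => ?_
  rw [hcomb, ← hφ_apply]
  have h1 := le_normV'_mul hφ_bdd χ
  have h2 := (neg_le_abs _).trans (hconv χ)
  linarith

end

/-! ### One step of the accelerated iteration -/

lemma sum_window_one {E : Type*} [AddCommMonoid E] {k : ℕ} (hk : 1 ≤ k) (F : ℕ → E) :
    ∑ j ∈ window 1 k, F j = F k + F (k + 1) := by
  have : window 1 k = {k, k + 1} := by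
    ext j
    simp only [window, min_eq_right hk, Finset.mem_Icc, Finset.mem_insert, Finset.mem_singleton]
    omega
  rw [this, Finset.sum_pair (by omega)]

end NSE

end

theorem mainTheorem1 (d : ℕ) (hd : d = 2 ∨ d = 3) (Ω : Set (NSE.Vec d)) (hΩ_open : IsOpen Ω)
    (hΩ_conn : IsConnected Ω) (hΩ_bdd : Bornology.IsBounded Ω)
    (ν : ℝ) (hν : 0 < ν) (f : NSE.HNegOne Ω)
    (M : ℝ) (hM : NSE.convConst Ω ≤ M) (κ : ℝ) (hκ_def : κ = NSE.kappa M ν f) (hκ : κ < 1)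
    (k : ℕ) (hk : 1 < k) (u ut : ℕ → NSE.V Ω) (α : ℕ → ℕ → ℝ)
    (hAAg : NSE.IsAAg ν f 1 k u ut α)
    (αbar : ℝ) (hα : ∀ j ∈ NSE.window 1 k, |α k j| ≤ αbar) :
    NSE.normV' (NSE.g ν f (u (k + 1))) ≤
        NSE.gain ν f 1 k ut α * κ * NSE.normV' (NSE.g ν f (u k)) +
          2 * M * αbar ^ 2 * κ ^ 2 / (ν ^ 2 * (1 - κ) ^ 2) *
            (NSE.normV' (NSE.g ν f (u k)) ^ 2 + NSE.normV' (NSE.g ν f (u (k - 1))) ^ 2) ∧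
      NSE.normV' (NSE.g ν f (u (k + 1))) ≤
        NSE.rate ν f 1 k u ut α * NSE.normV' (NSE.g ν f (u k)) +
          2 * M * αbar ^ 2 * κ ^ 2 / (ν ^ 2 * (1 - κ) ^ 2) *
            (NSE.normV' (NSE.g ν f (u k)) ^ 2 + NSE.normV' (NSE.g ν f (u (k - 1))) ^ 2) := by
  open NSE in
  subst hκ_def
  have hM0 : 0 ≤ M := convConst_nonneg.trans hM
  have B : IsConvective Ω M := isConvective hd hΩ_bdd hM
  have hf := le_normNegOne_mul hd hΩ_bdd f
  have hκ0 := kappa_nonneg hM0 ν f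
  have hP : IsPicard ν f (u k) (ut (k + 1)) := hAAg.picard k le_rfl
  have hP' : IsPicard ν f (u (k - 1)) (ut k) := by
    have h := hAAg.picard (k - 1) (by omega)
    rwa [Nat.sub_add_cancel hk.le] at h
  have hcomb (β : ℕ → ℝ) : combRes ν f 1 k ut β =
      β k • g ν f (ut k) + β (k + 1) • g ν f (ut (k + 1)) := sum_window_one hk.le _
  have hcomb_nonneg (β : ℕ → ℝ) : 0 ≤ normV' (combRes ν f 1 k ut β) := by
    refine normV'_nonneg fun χ => ?_
    simp only [hcomb, Pi.add_apply, Pi.smul_apply, smul_eq_mul, g_neg B]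
    ring
  -- Minimality, tested with the coefficients `(0, 1)` of the plain Picard step.
  have hmin : normV' (combRes ν f 1 k ut (α k)) ≤ normV' (g ν f (ut (k + 1))) := by
    have h := hAAg.minimal k le_rfl (fun j => if j = k + 1 then 1 else 0)
      (by rw [sum_window_one hk.le]; simp)
    have h' := (sq_le_sq₀ (hcomb_nonneg _) (hcomb_nonneg _)).1 h
    rw [hcomb fun j => if j = k + 1 then 1 else 0] at h'
    simpa using h'
  have hPg := hP.normV'_g_le hM0 hν B hf
  have hg0 := normV'_nonneg (g_neg (ν := ν) (f := f) B (u k))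
  have hgt0 := normV'_nonneg (g_neg (ν := ν) (f := f) B (ut (k + 1)))
  have hg0' := normV'_nonneg (g_neg (ν := ν) (f := f) B (u (k - 1)))
  have hstep : normV' (g ν f (u (k + 1))) ≤ normV' (combRes ν f 1 k ut (α k)) +
      2 * M * αbar ^ 2 * kappa M ν f ^ 2 / (ν ^ 2 * (1 - kappa M ν f) ^ 2) *
        (normV' (g ν f (u k)) ^ 2 + normV' (g ν f (u (k - 1))) ^ 2) := by
    have hsum : α k k + α k (k + 1) = 1 := by
      rw [← hAAg.sum_eq_one k le_rfl, sum_window_one hk.le]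
    have hwin : k ∈ window 1 k ∧ k + 1 ∈ window 1 k := by
      simp only [window, Finset.mem_Icc]; omega
    rw [hAAg.update k le_rfl, sum_window_one hk.le, hcomb]
    refine (normV'_g_affine_comb_le hM0 B hf hsum (hα _ hwin.1) (hα _ hwin.2)).trans ?_
    refine add_le_add le_rfl ?_
    have he := hP.norm_grad_sub_le_residuals hM0 hν B hf hP' hκ
    have hsq : (normV' (g ν f (u k)) + normV' (g ν f (u (k - 1)))) ^ 2 ≤
        2 * (normV' (g ν f (u k)) ^ 2 + normV' (g ν f (u (k - 1))) ^ 2) := add_sq_le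
    calc _ ≤ M * αbar ^ 2 * (kappa M ν f / (ν * (1 - kappa M ν f)) *
          (normV' (g ν f (u k)) + normV' (g ν f (u (k - 1))))) ^ 2 := by gcongr
      _ = M * αbar ^ 2 * (kappa M ν f / (ν * (1 - kappa M ν f))) ^ 2 *
          (normV' (g ν f (u k)) + normV' (g ν f (u (k - 1)))) ^ 2 := by ring
      _ ≤ M * αbar ^ 2 * (kappa M ν f / (ν * (1 - kappa M ν f))) ^ 2 *
          (2 * (normV' (g ν f (u k)) ^ 2 + normV' (g ν f (u (k - 1))) ^ 2)) := by gcongr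
      _ = _ := by rw [div_pow, mul_pow]; ring
  -- In both quotients the numerator vanishes with the denominator, by `hmin` and `hPg`.
  constructor
  · refine hstep.trans (add_le_add ?_ le_rfl)
    have hgain : gain ν f 1 k ut α * normV' (g ν f (ut (k + 1))) =
        normV' (combRes ν f 1 k ut (α k)) :=
      div_mul_cancel_of_imp fun h => le_antisymm (h ▸ hmin) (hcomb_nonneg _)
    rw [← hgain, mul_assoc]
    exact mul_le_mul_of_nonneg_left hPg (div_nonneg (hcomb_nonneg _) hgt0)
  · refine hstep.trans (add_le_add (le_of_eq ?_) le_rfl)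
    refine (div_mul_cancel_of_imp fun h => le_antisymm ?_ (hcomb_nonneg _)).symm
    rw [h, mul_zero] at hPg
    exact hmin.trans hPg
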